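/- Consider a circular metro line of $n$ segments, with nodes and segments indexed by $j$ modulo $n$ (segment $j$ goes from node $j-1$ to node $j$). Let $b_j\in\{0,1\}$ be the number of trains on segment $j$ at time zero, $\bar b_j=1-b_j$, and let $m=\sum_j b_j$ be the number of trains; assume $0<m<n$. Let $t_j\in\mathbb R$ and $s_j\in\mathbb R$ be the minimum travel time and the minimum safe separation time of segment $j$. The train dynamics is the max-plus linear system $$d^k_j=\max\{\,d^{k-b_j}_{j-1}+t_j,\; d^{k-\bar b_{j+1}}_{j+1}+s_{j+1}\,\},\qquad k\ge 1,\ j\in\mathbb Z/n\mathbb Z,$$ where $d^k_j$ is the instant of the $k$-th departure from node $j$ and $d^0\in\mathbb R^n$ is the initial condition. Put $$h=\max\Big\{\frac{\sum_j t_j}{m},\ \max_j (t_j+s_j),\ \frac{\sum_j s_j}{n-m}\Big\}.$$ Then the train dynamics converges to a stable stationary regime, with a unique asymptotic average growth vector, all of whose components are equal to the average train time-headway $h$, independently of the initial condition. Precisely: 1. Every initial condition $d^0\in\mathbb R^n$ determines exactly one trajectory $(d^k)_{k\ge 0}$. 2. There is a stationary regime, that is, a trajectory of the form $d^k_j=v_j+k\mu$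 with $v\in\mathbb R^n$, if and only if $\mu=h$. 3. The dynamics is stable: if two trajectories $d,e$ satisfy $|d^0_i-e^0_i|\le\varepsilon$ for all $i$, then $|d^k_j-e^k_j|\le\varepsilon$ for all $k$ and $j$. 4. Every trajectory reaches a periodic regime of average headway $h$: there are $K\ge 0$ and $c\ge 1$ with $d^{k+c}_j=d^k_j+c\,h$ for all $k\ge K$ and all $j$. 5. For every trajectory, $\lim_{k\to\infty} d^k_j/k=h$ for every $j$; that is, $(h,\dots,h)$ is its unique asymptotic average growth vector. -/

import Mathlib

open Filter Topology

noncomputable section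

/-- A circular metro line made of `n` segments. Nodes and segments are indexed modulo `n`, segment
`j` going from node `j - 1` to node `j`.
* `occupied j` tells whether a train stands on segment `j` at time zero (`b_j`);
* `t j` is the lower bound of the travel time on segment `j`;
* `s j` is the lower bound of the safe separation time of segment `j`. -/
structure MetroLine (n : ℕ) where
  occupied : ZMod n → Bool
  t : ZMod n → ℝ
  s : ZMod n → ℝ

namespace MetroLine

variable {n : ℕ}

/-- The number `b_j ∈ {0, 1}` of trains on segment `j` at time zero. -/
def b (L : MetroLine n) (j : ZMod n) : ℕ := (L.occupied j).toNat

/-- The number `1 - b_j ∈ {0, 1}`. -/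
def bbar (L : MetroLine n) (j : ZMod n) : ℕ := (!L.occupied j).toNat

/-- The number `m` of running trains. -/
def numTrains [NeZero n] (L : MetroLine n) : ℕ := ∑ j, L.b j

/-- The max-plus linear train dynamics: `d k j` is the instant of the `k`-th departure from node
`j`, `d 0` being the initial condition. The delays `b` and `bbar` are at most `1`, so the natural
number subtractions below are exact for `k ≥ 1`. -/
def IsTrajectory (L : MetroLine n) (d : ℕ → ZMod n → ℝ) : Prop :=
  ∀ k : ℕ, 1 ≤ k → ∀ j : ZMod n,
    d k j = max (d (k - L.b j) (j - 1) + L.t j)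
      (d (k - L.bbar (j + 1)) (j + 1) + L.s (j + 1))

/-- `χ` is the asymptotic average growth vector of the sequence `d` of departure times. -/
def IsGrowthVector (d : ℕ → ZMod n → ℝ) (χ : ZMod n → ℝ) : Prop :=
  ∀ j, Tendsto (fun k : ℕ => d k j / (k : ℝ)) atTop (𝓝 (χ j))

/-- The dynamics has a stationary regime with headway `μ`: a trajectory along which all nodes
are left at regular intervals `μ`. -/
def HasStationaryRegime (L : MetroLine n) (μ : ℝ) : Prop :=
  ∃ v : ZMod n → ℝ, L.IsTrajectory (fun k j => v j + (k : ℝ) * μ)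

/-- After finitely many steps `d` is in a periodic regime of average headway `μ`: every `c`
further departures take exactly the time `c * μ`, at every node. -/
def ReachesPeriodicRegime (d : ℕ → ZMod n → ℝ) (μ : ℝ) : Prop :=
  ∃ K c : ℕ, 1 ≤ c ∧ ∀ k, K ≤ k → ∀ j, d (k + c) j = d k j + (c : ℝ) * μ

/-- Stability: changing the initial condition by at most `ε` (in the sup norm) never changes any
departure time by more than `ε`. -/
def IsStable (L : MetroLine n) : Prop :=
  ∀ d e : ℕ → ZMod n → ℝ, L.IsTrajectory d → L.IsTrajectory e →
    ∀ ε : ℝ, (∀ i, |d 0 i - e 0 i| ≤ ε) → ∀ k j, |d k j - e k j| ≤ ε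

/-- The average train time-headway
`h = max {(∑ t_j) / m, max_j (t_j + s_j), (∑ s_j) / (n - m)}`. -/
def headway [NeZero n] (L : MetroLine n) : ℝ :=
  max ((∑ j, L.t j) / (L.numTrains : ℝ))
    (max (Finset.univ.sup' Finset.univ_nonempty (fun j => L.t j + L.s j))
      ((∑ j, L.s j) / ((n : ℝ) - (L.numTrains : ℝ))))

end MetroLine

end

/-! A regime `v j + k * μ` is a max-plus eigenvector on the circle with arc weights `t - b * μ` and
`s - bbar * μ`. The headway is the largest ratio of weight to delay over the simple circuits: the
two full turns and the two-arc loops. At `μ = h` no circuit is positive and one is zero, so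
longest-path lengths solve the equation (`exists_eigenvector`). As `0 < m < n`, no circuit has zero
delay. The implicit recursion is thus well-founded (`exists_wellFounded`), which gives unique
trajectories and nonexpansiveness (`isStable`). Every trajectory stays near a stationary regime,
which fixes its growth rate and forces `μ = h`. Its deviations take finitely many values
(`finite_range_sub_stationary`), so one recurs and the trajectory is eventually periodic. -/

namespace MetroLine

/-! ### Max-plus eigenvectors on a circle -/

section Circle

variable {n : ℕ} [NeZero n]

theorem exists_natCast_add_one_eq (j : ZMod n) : ∃ p < n, ((p : ZMod n) + 1) = j :=
  ⟨(j - 1).val, ZMod.val_lt _, by simp⟩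

theorem sum_range_natCast_add_one (f : ZMod n → ℝ) :
    ∑ q ∈ Finset.range n, f ((q : ZMod n) + 1) = ∑ j, f j := by
  rw [← Equiv.sum_comp (Equiv.addRight (1 : ZMod n)) f]
  refine Finset.sum_bij' (fun q _ => (q : ZMod n)) (fun j _ => j.val) ?_ ?_ ?_ ?_ ?_
  · simp
  · intro j _; simpa using ZMod.val_lt j
  · intro q hq; exact ZMod.val_natCast_of_lt (by simpa using hq)
  · intro j _; simp
  · intro q _; rfl

/-- A function on `{0, …, n}` with equal values at the ends descends to the circle. -/
theorem exists_lift_of_eq (V : ℕ → ℝ) (h : V 0 = V n) :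
    ∃ v : ZMod n → ℝ, ∀ p ≤ n, v (p : ZMod n) = V p := by
  refine ⟨fun j => V j.val, fun p hp => ?_⟩
  rcases hp.lt_or_eq with hp | rfl
  · simp only [ZMod.val_natCast_of_lt hp]
  · simp [h]

/-- A function of zero sum on the circle is a difference. -/
theorem exists_potential (f : ZMod n → ℝ) (hf : ∑ j, f j = 0) :
    ∃ u : ZMod n → ℝ, ∀ j, u j = u (j - 1) + f j := by
  obtain ⟨u, hu⟩ := exists_lift_of_eq (n := n)
    (fun p => ∑ q ∈ Finset.range p, f ((q : ZMod n) + 1))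
    (by simp [sum_range_natCast_add_one, hf])
  refine ⟨u, fun j => ?_⟩
  obtain ⟨p, hp, rfl⟩ := exists_natCast_add_one_eq j
  have h1 := hu (p + 1) hp
  rw [Finset.sum_range_succ, ← hu p hp.le] at h1
  simpa using h1

/-- Take the longest path from node `0`, either clockwise (`F`) or counterclockwise (`B`). Its last
arc gives equality away from `0`; at `0` equality needs a zero-weight circuit through `0`. -/
theorem exists_eigenvector_of_base (a c : ZMod n → ℝ) (hac : ∀ j, a j + c j ≤ 0)
    (ha : ∑ j, a j ≤ 0) (hc : ∑ j, c j ≤ 0)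
    (h0 : ∑ j, a j = 0 ∨ ∑ j, c j = 0 ∨ a 0 + c 0 = 0) :
    ∃ v : ZMod n → ℝ, ∀ j, v j = max (v (j - 1) + a j) (v (j + 1) + c (j + 1)) := by
  have hn : 0 < n := Nat.pos_of_ne_zero (NeZero.ne n)
  set F : ℕ → ℝ := fun p => ∑ q ∈ Finset.range p, a ((q : ZMod n) + 1) with hF
  set B : ℕ → ℝ := fun p => ∑ j, c j - ∑ q ∈ Finset.range p, c ((q : ZMod n) + 1) with hB
  have hFs (p : ℕ) : F (p + 1) = F p + a (p + 1) := Finset.sum_range_succ ..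
  have hBs (p : ℕ) : B p = B (p + 1) + c (p + 1) := by
    simp only [hB, Finset.sum_range_succ]; ring
  have hF0 : F 0 = 0 := by simp [hF]
  have hB0 : B 0 = ∑ j, c j := by simp [hB]
  have hFn : F n = ∑ j, a j := sum_range_natCast_add_one a
  have hBn : B n = 0 := by simp [hB, sum_range_natCast_add_one c]
  have hV0 : max (F 0) (B 0) = 0 := by rw [hF0, hB0, max_eq_left hc]
  have hVn : max (F n) (B n) = 0 := by rw [hFn, hBn, max_eq_right ha]
  obtain ⟨v, hv⟩ := exists_lift_of_eq (n := n) (fun p => max (F p) (B p)) (hV0.trans hVn.symm)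
  have hv' (p : ℕ) (hp : p < n) : v ((p : ZMod n) + 1) = max (F (p + 1)) (B (p + 1)) := by
    simpa using hv (p + 1) hp
  have hfwd (j : ZMod n) : v (j - 1) + a j ≤ v j := by
    obtain ⟨p, hp, rfl⟩ := exists_natCast_add_one_eq j
    rw [add_sub_cancel_right, hv p hp.le, hv' p hp, hFs, ← max_add_add_right]
    refine max_le_max le_rfl ?_
    linarith [hBs p, hac (p + 1)]
  have hbwd (j : ZMod n) : v (j + 1) + c (j + 1) ≤ v j := by
    obtain ⟨p, hp, hj⟩ := exists_natCast_add_one_eq (j + 1)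
    obtain rfl : (p : ZMod n) = j := add_right_cancel hj
    rw [hv p hp.le, hv' p hp, hBs p, ← max_add_add_right]
    refine max_le_max ?_ le_rfl
    linarith [hFs p, hac (p + 1)]
  have hF_le (p : ℕ) (hp : p < n) : F (p + 1) ≤ v p + a (p + 1) := by
    rw [hv p hp.le, hFs]; gcongr; exact le_max_left _ _
  have hB_le (p : ℕ) (hp : p < n) : B p ≤ v (p + 1) + c (p + 1) := by
    rw [hv' p hp, hBs]; gcongr; exact le_max_right _ _
  refine ⟨v, fun j => le_antisymm ?_ (max_le (hfwd j) (hbwd j))⟩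
  obtain ⟨p, hp, rfl⟩ := exists_natCast_add_one_eq j
  rw [add_sub_cancel_right]
  rcases (Nat.succ_le_of_lt hp).lt_or_eq with hp' | hp'
  · rw [hv' p hp]
    refine max_le_max (hF_le p hp) ?_
    simpa using hB_le (p + 1) hp'
  -- The base node, whose optimal path is empty: the critical circuit supplies the attaining arc.
  · have hcast : (p : ZMod n) + 1 = 0 := by
      have : ((p + 1 : ℕ) : ZMod n) = (n : ZMod n) := congrArg _ hp'
      simpa using this
    have hzero : v ((p : ZMod n) + 1) = 0 := by
      rw [hv' p hp]; simpa [← hp'] using hVn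
    rw [hzero, le_max_iff]
    rcases h0 with h | h | h
    · left
      have := hF_le p hp
      rwa [show p + 1 = n from hp', hFn, h] at this
    · right
      have := hB_le 0 hn
      rw [hB0, h] at this
      simpa [hcast] using this
    · left
      have h1 : B p ≤ v p := by rw [hv p hp.le]; exact le_max_right _ _
      rw [hBs p, show p + 1 = n from hp', hBn, hcast] at h1
      rw [hcast]
      linarith

/-- The longest-path eigenvector of a circle whose arcs `j - 1 → j` and `j → j - 1` have weights `a j`
and `c j`, when no circuit has positive weight and some circuit has weight zero. -/
theorem exists_eigenvector (a c : ZMod n → ℝ) (hac : ∀ j, a j + c j ≤ 0)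
    (ha : ∑ j, a j ≤ 0) (hc : ∑ j, c j ≤ 0)
    (h0 : ∑ j, a j = 0 ∨ ∑ j, c j = 0 ∨ ∃ i, a i + c i = 0) :
    ∃ v : ZMod n → ℝ, ∀ j, v j = max (v (j - 1) + a j) (v (j + 1) + c (j + 1)) := by
  obtain ⟨i, hi⟩ : ∃ i, ∑ j, a j = 0 ∨ ∑ j, c j = 0 ∨ a i + c i = 0 := by
    rcases h0 with h | h | ⟨i, h⟩
    exacts [⟨0, .inl h⟩, ⟨0, .inr (.inl h)⟩, ⟨i, .inr (.inr h)⟩]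
  have hsum (f : ZMod n → ℝ) : ∑ j, f (j + i) = ∑ j, f j :=
    Equiv.sum_comp (Equiv.addRight i) f
  obtain ⟨v, hv⟩ := exists_eigenvector_of_base (fun j => a (j + i)) (fun j => c (j + i))
    (fun j => hac _) (by rwa [hsum]) (by rwa [hsum]) (by simpa only [hsum, zero_add] using hi)
  refine ⟨fun j => v (j - i), fun j => ?_⟩
  have := hv (j - i)
  rwa [show j - i - 1 = j - 1 - i by ring, show j - i + 1 = j + 1 - i by ring,
    sub_add_cancel, sub_add_cancel] at this

end Circle

/-- The additive monoid generated by finitely many nonpositive reals has only finitely many elements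
above any given bound. -/
theorem finite_setOf_mem_closure_ge (G : Set ℝ) (hG : G.Finite) (hG0 : ∀ g ∈ G, g ≤ 0) (C : ℝ) :
    {x | x ∈ AddSubmonoid.closure G ∧ C ≤ x}.Finite := by
  obtain ⟨δ, hδ, hGδ⟩ : ∃ δ > 0, ∀ g ∈ G, g = 0 ∨ g ≤ -δ := by
    induction G, hG using Set.Finite.induction_on with
    | empty => exact ⟨1, one_pos, by simp⟩
    | @insert g G _ _ ih =>
      obtain ⟨δ, hδ, h⟩ := ih fun g hg => hG0 g (.inr hg)
      rcases (hG0 g (.inl rfl)).lt_or_eq with hg | hg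
      · refine ⟨min δ (-g), lt_min hδ (by linarith), ?_⟩
        rintro x (rfl | hx)
        · right; linarith [min_le_right δ (-x)]
        · refine (h x hx).imp_right fun hx => ?_
          linarith [min_le_left δ (-g)]
      · refine ⟨δ, hδ, ?_⟩
        rintro x (rfl | hx)
        exacts [.inl hg, h x hx]
  let T : ℕ → Set ℝ := fun N => Nat.rec {0} (fun _ S => Set.image2 (· + ·) G S) N
  have hT (N : ℕ) : (T N).Finite := by
    induction N with
    | zero => exact Set.finite_singleton _
    | succ N ih => exact Set.Finite.image2 _ hG ih
  -- Zero summands are dropped, so each of the `N` summands costs at least `δ`; a lower bound on `x`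
  -- then bounds `N`.
  have hmem : ∀ x ∈ AddSubmonoid.closure G, ∃ N : ℕ, x ∈ T N ∧ x ≤ -(N * δ) := by
    intro x hx
    induction hx using AddSubmonoid.closure_induction_left with
    | zero => exact ⟨0, rfl, by simp⟩
    | add_left g hg y _ ih =>
      obtain ⟨N, hy, hyN⟩ := ih
      rcases hGδ g hg with rfl | h
      · exact ⟨N, by simpa using hy, by simpa using hyN⟩
      · exact ⟨N + 1, Set.mem_image2_of_mem hg hy, by push_cast; linarith⟩
  obtain ⟨M, hM⟩ := exists_nat_gt (-C / δ)
  rw [div_lt_iff₀ hδ] at hM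
  refine ((Set.finite_lt_nat M).biUnion fun N _ => hT N).subset fun x hx => ?_
  obtain ⟨N, hN, hxN⟩ := hmem x hx.1
  refine Set.mem_biUnion (x := N) ?_ hN
  have : (N : ℝ) * δ < M * δ := by linarith [hx.2]
  exact_mod_cast lt_of_mul_lt_mul_right this hδ.le

/-! ### Solvability and stability of the implicit dynamics -/

variable {n : ℕ} (L : MetroLine n)

theorem b_add_bbar (j : ZMod n) : L.b j + L.bbar j = 1 := by
  unfold b bbar; cases L.occupied j <;> rfl

theorem b_eq_zero_or_one (j : ZMod n) : L.b j = 0 ∨ L.b j = 1 := by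
  have := L.b_add_bbar j; omega

theorem bbar_eq_zero_or_one (j : ZMod n) : L.bbar j = 0 ∨ L.bbar j = 1 := by
  have := L.b_add_bbar j; omega

/-- The nodes can be ordered so that every arc without delay points upwards. -/
theorem exists_wellFounded [NeZero n] (hpos : 0 < L.numTrains) (hlt : L.numTrains < n) :
    ∃ r : ZMod n → ZMod n → Prop, WellFounded r ∧
      (∀ j, L.b j = 0 → r (j - 1) j) ∧ ∀ j, L.bbar (j + 1) = 0 → r (j + 1) j := by
  -- The increments `m - n * b j` sum to zero; `u` rises by `m` or `n - m` along each delay-free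
  -- arc.
  obtain ⟨u, hu⟩ := exists_potential
    (fun j => (L.numTrains : ℝ) - n * (L.b j : ℝ)) (by
      rw [Finset.sum_sub_distrib, ← Finset.mul_sum, ← Nat.cast_sum]
      simp [numTrains, ZMod.card])
  have h1 : (0 : ℝ) < L.numTrains := by exact_mod_cast hpos
  have h2 : (L.numTrains : ℝ) < n := by exact_mod_cast hlt
  refine ⟨InvImage (· < ·) u, ?_, fun j hj => ?_, fun j hj => ?_⟩
  · have : IsTrans _ (InvImage (· < ·) u) := ⟨fun _ _ _ => lt_trans (α := ℝ)⟩
    have : Std.Irrefl (InvImage (· < ·) u) := ⟨fun _ => lt_irrefl (α := ℝ) _⟩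
    exact Finite.wellFounded_of_trans_of_irrefl _
  · have := hu j
    simp only [hj, Nat.cast_zero, mul_zero, sub_zero] at this
    show u (j - 1) < u j
    linarith
  · have := hu (j + 1)
    have hb : L.b (j + 1) = 1 := by have := L.b_add_bbar (j + 1); omega
    simp only [hb, Nat.cast_one, mul_one, add_sub_cancel_right] at this
    show u (j + 1) < u j
    linarith

variable {L}

/-- `max` is nonexpansive; the inner induction follows the delay-free arcs within one step. -/
theorem isStable [NeZero n] (hpos : 0 < L.numTrains) (hlt : L.numTrains < n) : L.IsStable := by
  obtain ⟨r, hr, hr1, hr2⟩ := L.exists_wellFounded hpos hlt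
  intro d e hd he ε h0 k
  induction k with
  | zero => exact h0
  | succ k ih =>
    intro j
    induction j using hr.induction with
    | _ j ihj =>
      have hfwd : |d (k + 1 - L.b j) (j - 1) - e (k + 1 - L.b j) (j - 1)| ≤ ε := by
        rcases L.b_eq_zero_or_one j with h | h
        · rw [h]; exact ihj _ (hr1 j h)
        · rw [h]; exact ih _
      have hbwd : |d (k + 1 - L.bbar (j + 1)) (j + 1) - e (k + 1 - L.bbar (j + 1)) (j + 1)| ≤ ε := by
        rcases L.bbar_eq_zero_or_one (j + 1) with h | h
        · rw [h]; exact ihj _ (hr2 j h)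
        · rw [h]; exact ih _
      rw [hd (k + 1) (by omega) j, he (k + 1) (by omega) j]
      refine (abs_max_sub_max_le_max _ _ _ _).trans (max_le ?_ ?_) <;>
        rwa [add_sub_add_right_eq_sub]

theorem IsStable.eq_of_zero_eq (hL : L.IsStable) {d e : ℕ → ZMod n → ℝ} (hd : L.IsTrajectory d)
    (he : L.IsTrajectory e) (h : d 0 = e 0) : d = e := by
  ext k j
  have := hL d e hd he 0 (by simp [h]) k j
  exact sub_eq_zero.1 (abs_nonpos_iff.1 this)

/-- One step of the implicit dynamics can be solved. -/
theorem exists_next [NeZero n] (hpos : 0 < L.numTrains) (hlt : L.numTrains < n)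
    (x : ZMod n → ℝ) : ∃ y : ZMod n → ℝ, ∀ j, y j =
      max ((if L.b j = 0 then y (j - 1) else x (j - 1)) + L.t j)
        ((if L.bbar (j + 1) = 0 then y (j + 1) else x (j + 1)) + L.s (j + 1)) := by
  obtain ⟨r, hr, hr1, hr2⟩ := L.exists_wellFounded hpos hlt
  refine ⟨hr.fix fun j y => max
    ((if h : L.b j = 0 then y (j - 1) (hr1 j h) else x (j - 1)) + L.t j)
    ((if h : L.bbar (j + 1) = 0 then y (j + 1) (hr2 j h) else x (j + 1)) + L.s (j + 1)),
    fun j => ?_⟩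
  rw [hr.fix_eq]
  simp only [dite_eq_ite]

theorem exists_isTrajectory [NeZero n] (hpos : 0 < L.numTrains) (hlt : L.numTrains < n)
    (d₀ : ZMod n → ℝ) : ∃ d : ℕ → ZMod n → ℝ, d 0 = d₀ ∧ L.IsTrajectory d := by
  choose f hf using exists_next (L := L) hpos hlt
  refine ⟨fun k => f^[k] d₀, rfl, fun k hk j => ?_⟩
  obtain ⟨k, rfl⟩ := Nat.exists_eq_add_of_le' hk
  simp only [Function.iterate_succ_apply']
  rw [hf]
  congr 2
  · rcases L.b_eq_zero_or_one j with h | h <;> simp [h, Function.iterate_succ_apply']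
  · rcases L.bbar_eq_zero_or_one (j + 1) with h | h <;> simp [h, Function.iterate_succ_apply']

/-! ### Stationary regimes and growth rate -/

/-- The eigenvector equation of the stationary regimes. -/
theorem isTrajectory_linear_iff {v : ZMod n → ℝ} {μ : ℝ} :
    L.IsTrajectory (fun k j => v j + (k : ℝ) * μ) ↔
      ∀ j, v j = max (v (j - 1) + (L.t j - L.b j * μ))
        (v (j + 1) + (L.s (j + 1) - L.bbar (j + 1) * μ)) := by
  have key (k : ℕ) (hk : 1 ≤ k) (j : ZMod n) :
      max (v (j - 1) + ((k - L.b j : ℕ) : ℝ) * μ + L.t j)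
        (v (j + 1) + ((k - L.bbar (j + 1) : ℕ) : ℝ) * μ + L.s (j + 1)) =
      max (v (j - 1) + (L.t j - L.b j * μ))
        (v (j + 1) + (L.s (j + 1) - L.bbar (j + 1) * μ)) + k * μ := by
    have h1 := L.b_eq_zero_or_one j
    have h2 := L.bbar_eq_zero_or_one (j + 1)
    rw [Nat.cast_sub (by omega), Nat.cast_sub (by omega), ← max_add_add_right]
    congr 1 <;> ring
  constructor
  · intro h j
    have := h 1 le_rfl j
    dsimp only at this
    rw [key 1 le_rfl j] at this
    exact add_right_cancel this
  · intro h k hk j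
    dsimp only
    rw [key k hk j, ← h j]

theorem hasStationaryRegime_headway [NeZero n] (hpos : 0 < L.numTrains) (hlt : L.numTrains < n) :
    L.HasStationaryRegime L.headway := by
  have hm : (0 : ℝ) < L.numTrains := by exact_mod_cast hpos
  have hm' : (0 : ℝ) < n - L.numTrains := sub_pos.2 (by exact_mod_cast hlt)
  set h := L.headway with hh
  have hb (j : ZMod n) : (L.b j : ℝ) + L.bbar j = 1 := by exact_mod_cast L.b_add_bbar j
  have hac (j : ZMod n) :
      (L.t j - L.b j * h) + (L.s j - L.bbar j * h) = L.t j + L.s j - h := by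
    linear_combination -h * hb j
  have hsb : ∑ j, (L.b j : ℝ) = L.numTrains := by simp [numTrains]
  have hsbbar : ∑ j, (L.bbar j : ℝ) = n - L.numTrains := by
    rw [← hsb, eq_sub_iff_add_eq', ← Finset.sum_add_distrib]
    simp [hb, ZMod.card]
  have ha : ∑ j, (L.t j - L.b j * h) = ∑ j, L.t j - h * L.numTrains := by
    rw [Finset.sum_sub_distrib, ← Finset.sum_mul, hsb, mul_comm]
  have hc : ∑ j, (L.s j - L.bbar j * h) = ∑ j, L.s j - h * (n - L.numTrains) := by
    rw [Finset.sum_sub_distrib, ← Finset.sum_mul, hsbbar, mul_comm]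
  obtain ⟨v, hv⟩ := exists_eigenvector (fun j => L.t j - L.b j * h) (fun j => L.s j - L.bbar j * h)
    (fun j => by
      have h1 := Finset.le_sup' (fun j => L.t j + L.s j) (Finset.mem_univ j)
      have h2 : L.t j + L.s j ≤ h := h1.trans ((le_max_left _ _).trans (le_max_right _ _))
      linarith [hac j])
    (by
      rw [ha, sub_nonpos, ← div_le_iff₀ hm]
      exact le_max_left _ _)
    (by
      rw [hc, sub_nonpos, ← div_le_iff₀ hm']
      exact (le_max_right _ _).trans (le_max_right _ _))
    (by
      rw [ha, hc, sub_eq_zero, sub_eq_zero, ← div_eq_iff hm.ne', ← div_eq_iff hm'.ne']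
      simp only [hac, sub_eq_zero]
      obtain ⟨i, -, hi⟩ := Finset.exists_mem_eq_sup' (Finset.univ_nonempty (α := ZMod n))
        (fun j => L.t j + L.s j)
      have hmax (x y z : ℝ) : x = max x (max y z) ∨ z = max x (max y z) ∨ y = max x (max y z) := by
        rcases max_choice x (max y z) with h1 | h1 <;> rcases max_choice y z with h2 | h2 <;> simp_all
      refine (hmax _ _ _).imp id (Or.imp id fun h3 => ⟨i, hi.symm.trans h3⟩))
  exact ⟨v, isTrajectory_linear_iff.2 hv⟩

/-- A trajectory stays at bounded distance from any stationary regime. -/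
theorem IsStable.exists_abs_sub_le [NeZero n] (hL : L.IsStable) {d e : ℕ → ZMod n → ℝ}
    (hd : L.IsTrajectory d) (he : L.IsTrajectory e) :
    ∃ C, ∀ k j, |d k j - e k j| ≤ C :=
  ⟨∑ i, |d 0 i - e 0 i|, hL d e hd he _ fun i =>
    Finset.single_le_sum (f := fun i => |d 0 i - e 0 i|) (fun _ _ => abs_nonneg _)
      (Finset.mem_univ i)⟩

theorem tendsto_div_of_abs_sub_le {x : ℕ → ℝ} {v μ C : ℝ} (h : ∀ k : ℕ, |x k - (v + k * μ)| ≤ C) :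
    Tendsto (fun k : ℕ => x k / k) atTop (𝓝 μ) := by
  have h0 : Tendsto (fun k : ℕ => (x k - k * μ) / k) atTop (𝓝 0) := by
    refine squeeze_zero_norm (a := fun k : ℕ => (C + |v|) / k) (fun k => ?_)
      (tendsto_const_div_atTop_nhds_zero_nat _)
    rw [norm_div, Real.norm_natCast, Real.norm_eq_abs]
    gcongr
    calc |x k - k * μ| = |(x k - (v + k * μ)) + v| := by ring_nf
      _ ≤ C + |v| := (abs_add_le _ _).trans (by gcongr; exact h k)
  have h1 := h0.add_const μ
  rw [zero_add] at h1
  refine h1.congr' ?_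
  filter_upwards [eventually_gt_atTop 0] with k hk
  have : (k : ℝ) ≠ 0 := by positivity
  field_simp
  ring

theorem IsStable.isGrowthVector [NeZero n] (hL : L.IsStable) {μ : ℝ}
    (hμ : L.HasStationaryRegime μ) {d : ℕ → ZMod n → ℝ} (hd : L.IsTrajectory d) :
    IsGrowthVector d fun _ => μ := by
  obtain ⟨v, hv⟩ := hμ
  obtain ⟨C, hC⟩ := hL.exists_abs_sub_le hd hv
  exact fun j => tendsto_div_of_abs_sub_le (v := v j) fun k => hC k j

theorem IsTrajectory.shift {d : ℕ → ZMod n → ℝ} (hd : L.IsTrajectory d) (K : ℕ) (a : ℝ) :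
    L.IsTrajectory fun k j => d (K + k) j + a := by
  intro k hk j
  have h1 := L.b_eq_zero_or_one j
  have h2 := L.bbar_eq_zero_or_one (j + 1)
  dsimp only
  rw [hd (K + k) (by omega) j, ← max_add_add_right, Nat.add_sub_assoc (by omega),
    Nat.add_sub_assoc (by omega)]
  congr 1 <;> ring

/-! ### Eventual periodicity -/

/-- Seen from a stationary regime, a trajectory only takes finitely many values. -/
theorem finite_range_sub_stationary [NeZero n] (hpos : 0 < L.numTrains) (hlt : L.numTrains < n)
    {v : ZMod n → ℝ} {μ : ℝ} (hv : L.IsTrajectory fun k j => v j + (k : ℝ) * μ)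
    {d : ℕ → ZMod n → ℝ} (hd : L.IsTrajectory d) :
    (Set.range fun k j => d k j - (v j + k * μ)).Finite := by
  have hv' := isTrajectory_linear_iff.1 hv
  set a : ZMod n → ℝ := fun j => v (j - 1) + (L.t j - L.b j * μ) - v j with ha
  set c : ZMod n → ℝ := fun j => v (j + 1) + (L.s (j + 1) - L.bbar (j + 1) * μ) - v j with hc
  have ha0 (j) : a j ≤ 0 := sub_nonpos.2 (by rw [hv' j]; exact le_max_left _ _)
  have hc0 (j) : c j ≤ 0 := sub_nonpos.2 (by rw [hv' j]; exact le_max_right _ _)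
  set G : Set ℝ := Set.range a ∪ Set.range c
  have hG : G.Finite := (Set.finite_range a).union (Set.finite_range c)
  have hG0 : ∀ g ∈ G, g ≤ 0 := by
    rintro _ (⟨j, rfl⟩ | ⟨j, rfl⟩)
    exacts [ha0 j, hc0 j]
  set y : ℕ → ZMod n → ℝ := fun k j => d k j - (v j + k * μ) with hy
  have hstep (k : ℕ) (hk : 1 ≤ k) (j : ZMod n) :
      y k j = max (y (k - L.b j) (j - 1) + a j) (y (k - L.bbar (j + 1)) (j + 1) + c j) := by
    have h1 := L.b_eq_zero_or_one j
    have h2 := L.bbar_eq_zero_or_one (j + 1)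
    simp only [hy, ha, hc]
    rw [hd k hk j, ← max_sub_sub_right, Nat.cast_sub (by omega), Nat.cast_sub (by omega)]
    congr 1 <;> ring
  obtain ⟨r, hr, hr1, hr2⟩ := L.exists_wellFounded hpos hlt
  -- Following the maximizing arcs back to time zero writes `y k j` as an initial deviation plus a
  -- sum of slacks.
  have hmem : ∀ k j, ∃ i, y k j - y 0 i ∈ AddSubmonoid.closure G := by
    intro k
    induction k with
    | zero => exact fun j => ⟨j, by simp⟩
    | succ k ih =>
      intro j
      induction j using hr.induction with
      | _ j ihj =>
        have hfwd : ∃ i, y (k + 1 - L.b j) (j - 1) - y 0 i ∈ AddSubmonoid.closure G := by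
          rcases L.b_eq_zero_or_one j with h | h
          · rw [h]; exact ihj _ (hr1 j h)
          · rw [h]; exact ih _
        have hbwd : ∃ i, y (k + 1 - L.bbar (j + 1)) (j + 1) - y 0 i ∈ AddSubmonoid.closure G := by
          rcases L.bbar_eq_zero_or_one (j + 1) with h | h
          · rw [h]; exact ihj _ (hr2 j h)
          · rw [h]; exact ih _
        rw [hstep (k + 1) (by omega) j]
        rcases max_choice (y (k + 1 - L.b j) (j - 1) + a j)
          (y (k + 1 - L.bbar (j + 1)) (j + 1) + c j) with h | h <;> rw [h]
        · refine hfwd.imp fun i hi => ?_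
          rw [add_sub_right_comm]
          exact add_mem hi (AddSubmonoid.subset_closure (.inl ⟨j, rfl⟩))
        · refine hbwd.imp fun i hi => ?_
          rw [add_sub_right_comm]
          exact add_mem hi (AddSubmonoid.subset_closure (.inr ⟨j, rfl⟩))
  obtain ⟨C, hC⟩ := (isStable hpos hlt).exists_abs_sub_le hd hv
  set T : Set ℝ := ⋃ i, (fun x => x + y 0 i) ''
    {x | x ∈ AddSubmonoid.closure G ∧ -C - C ≤ x}
  have hT : T.Finite := Set.finite_iUnion fun i =>
    (finite_setOf_mem_closure_ge G hG hG0 _).image _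
  refine (Set.Finite.pi' fun _ : ZMod n => hT).subset ?_
  rintro _ ⟨k, rfl⟩ j
  obtain ⟨i, hi⟩ := hmem k j
  refine Set.mem_iUnion.2 ⟨i, y k j - y 0 i, ⟨hi, ?_⟩, sub_add_cancel _ _⟩
  have h1 := (abs_le.1 (hC k j)).1
  have h2 := (abs_le.1 (hC 0 i)).2
  simp only [hy]
  linarith

theorem reachesPeriodicRegime [NeZero n] (hpos : 0 < L.numTrains) (hlt : L.numTrains < n)
    {μ : ℝ} (hμ : L.HasStationaryRegime μ) {d : ℕ → ZMod n → ℝ} (hd : L.IsTrajectory d) :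
    ReachesPeriodicRegime d μ := by
  obtain ⟨v, hv⟩ := hμ
  have hfin := finite_range_sub_stationary hpos hlt hv hd
  obtain ⟨K, -, K', -, hlt', hK⟩ := Set.infinite_univ.exists_lt_map_eq_of_mapsTo
    (fun k _ => Set.mem_range_self k) hfin
  obtain ⟨c, rfl⟩ := Nat.exists_eq_add_of_lt hlt'
  -- Equal deviations at two times: the trajectories restarted there differ by a constant initially,
  -- hence forever.
  have heq := (isStable hpos hlt).eq_of_zero_eq (hd.shift (K + c + 1) 0)
    (hd.shift K ((c + 1 : ℕ) * μ)) (by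
      ext j
      have := congrFun hK j
      push_cast at this ⊢
      simp only [add_zero]
      linarith)
  refine ⟨K, c + 1, by omega, fun k hk j => ?_⟩
  obtain ⟨l, rfl⟩ := Nat.exists_eq_add_of_le hk
  have := congrFun (congrFun heq l) j
  rw [add_zero] at this
  rw [← this]
  congr 1
  omega

end MetroLine

theorem mainTheorem1 (n : ℕ) [NeZero n] (L : MetroLine n)
    (hpos : 0 < L.numTrains) (hlt : L.numTrains < n) :
    (∀ d₀ : ZMod n → ℝ, ∃! d : ℕ → ZMod n → ℝ, d 0 = d₀ ∧ L.IsTrajectory d) ∧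
    (∀ μ : ℝ, L.HasStationaryRegime μ ↔ μ = L.headway) ∧
    L.IsStable ∧
    (∀ d : ℕ → ZMod n → ℝ, L.IsTrajectory d →
      MetroLine.ReachesPeriodicRegime d L.headway ∧
      ∀ χ : ZMod n → ℝ, MetroLine.IsGrowthVector d χ ↔ χ = fun _ => L.headway) := by
  have hS := MetroLine.isStable hpos hlt
  have hH := MetroLine.hasStationaryRegime_headway hpos hlt
  have huniq {d : ℕ → ZMod n → ℝ} (hd : L.IsTrajectory d) {χ : ZMod n → ℝ}
      (hχ : MetroLine.IsGrowthVector d χ) : χ = fun _ => L.headway :=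
    funext fun j => tendsto_nhds_unique (hχ j) (hS.isGrowthVector hH hd j)
  refine ⟨fun d₀ => ?_, fun μ => ⟨fun hμ => ?_, fun hμ => hμ ▸ hH⟩, hS, fun d hd =>
    ⟨MetroLine.reachesPeriodicRegime hpos hlt hH hd, fun χ => ⟨huniq hd, ?_⟩⟩⟩
  · obtain ⟨d, hd0, hd⟩ := MetroLine.exists_isTrajectory hpos hlt d₀
    exact ⟨d, ⟨hd0, hd⟩, fun e he => hS.eq_of_zero_eq he.2 hd (he.1.trans hd0.symm)⟩
  · obtain ⟨v, hv⟩ := id hμ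
    exact congrFun (huniq hv (hS.isGrowthVector hμ hv)) 0
  · rintro rfl
    exact hS.isGrowthVector hH hd
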